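/- Let $N\ge 0$ and let $A_I^0,A_O^0,A_I^1,\dots,A_O^{N-1},A_I^N$ be nonzero finite-dimensional Hilbert spaces with fixed orthonormal bases (sites $0,\dots,N$; the last site has only an input space). Choi matrices are $T=\sum_{a,b}|a\rangle\langle b|\otimes\mathcal T(|a\rangle\langle b|)$. **Classical-memory processes.** A *classical-memory datum* consists of finite nonempty sets of settings $S_0,\dots,S_N$ and of outcomes $M_1,\dots,M_N$, a probability distribution $p(s_0)$ and density matrices $\rho_{s_0}$ on $A_I^0$, conditional distributions $p(s_n\mid s_0,\dots,s_{n-1},m_1,\dots,m_{n-1})$ on $S_n$, and for each $s_n\in S_n$ a quantum instrument $\{T^n_{m_n|s_n}\}_{m_n\in M_n}$ from $A_O^{n-1}$ to $A_I^n$ (Choi matrices $T^n_{m|s}\ge 0$ with $\mathrm{Tr}_{A_I^n}\sum_m T^n_{m|s}=\mathbb 1$), $1\le n\le N$. Its process matrix is $$W_{\rm CM}=\sum_{\vec s,\vec m}p(s_0)\,\rho_{s_0}\otimes\bigotimes_{n=1}^{N}p(s_n\mid s_0,\dots,s_{n-1},m_1,\dots,m_{n-1})\,T^n_{m_n|s_n}.$$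 **Circuits of nested controlled unitaries.** Such a circuit has environment registers with fixed orthonormal bases labelled by finite sets: $S_0$ and, for $1\le n\le N$, $S_n$, $M_n$, $K_n$, with $S_n, M_n$ nonempty. It starts in an arbitrary density matrix on $A_I^0\otimes\mathbb C^{S_0}$. At step $n$ fresh registers $\mathbb C^{S_n}$ and $\mathbb C^{X_n}$ are supplied in basis states $|0\rangle$; then, with $h=(s_0,s_1,m_1,\dots,s_{n-1},m_{n-1})$ running over the basis labels of the earlier $S$- and $M$-registers, one applies the controlled rotation $\sum_h|h\rangle\langle h|\otimes R^n_h$ with unitaries $R^n_h$ on $\mathbb C^{S_n}$, followed by the controlled unitary $\sum_{h,s}|h,s\rangle\langle h,s|\otimes U^n_{h,s}$ with unitaries $U^n_{h,s}:A_O^{n-1}\otimes\mathbb C^{X_n}\to A_I^n\otimes\mathbb C^{M_n}\otimes\mathbb C^{K_n}$. After the preparation and after every step, any (possibly trivial or degenerate) projective measurement of the environment that is diagonal in the fixed basis may be made, its result being forgotten. The process matrix of the circuit is the link product of the initial state, the fresh registers and the Choi matrices of the steps (with the measurements inserted), with the environment traced out at the end. **Claim.** 1. An operator $W$ on $A_I^0\otimes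 A_O^0\otimes\cdots\otimes A_I^N$ is the process matrix of some classical-memory datum if and only if it is the process matrix of some circuit of nested controlled unitaries with some choice of measurements. 2. More precisely, for every classical-memory datum there are registers $K_n,X_n$ and a circuit on the registers $S_n,M_n,K_n,X_n$ with initial state $\sum_{s}p(s)\rho_s\otimes|s\rangle\langle s|$, with $R^n_h|0\rangle=\sum_{s}\sqrt{p(s\mid h)}\,|s\rangle$, with $U^n_{h,s}=U^n_s$ depending only on $s$, and with $T^n_{m|s}$ being the Choi matrix of $\sigma\mapsto\mathrm{Tr}_{M_nK_n}\big[(\mathbb 1\otimes|m\rangle\langle m|_{M_n})\,U^n_s(\sigma\otimes|0\rangle\langle 0|)U_s^{n\dagger}\big]$, whose process matrix is the $W_{\rm CM}$ of the datum, whichever of the above measurements on the environment are made (in particular if none is made). 3. In every such circuit the total system-environment operator of each step (controlled rotation followed by controlled unitary) is unitary. -/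

import Mathlib

open scoped ComplexOrder Kronecker

namespace ClassicalMemoryProcess

/-! ### Sites

Sites and gates are numbered from `0`.  Site `n` has the input Hilbert space `ℂ^(I n)` and the output
Hilbert space `ℂ^(O n)`.  A process with `N` gates has the sites `0, …, N`; gate `n` sits between the
output of site `n` and the input of site `n + 1`, and the last site `N` has an input space only.
Only `I 0, …, I N` and `O 0, …, O (N - 1)` enter. -/

/-- Basis labels of `I₀ ⊗ (O₀ ⊗ I₁) ⊗ ⋯ ⊗ (Oₙ₋₁ ⊗ Iₙ)`, the space of process matrices with `n`
gates. -/
def Sites (I O : ℕ → Type) : ℕ → Type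
  | 0 => I 0
  | n + 1 => Sites I O n × (O n × I (n + 1))

/-- Classical records `(s₀, s₁, m₁, …, sₙ, mₙ)` of settings and outcomes. (`M 0` is not used.) -/
def Hist (S M : ℕ → Type) : ℕ → Type
  | 0 => S 0
  | n + 1 => Hist S M n × (S (n + 1) × M (n + 1))

instance Hist.instFintype (S M : ℕ → Type) [∀ n, Fintype (S n)] [∀ n, Fintype (M n)] :
    ∀ n, Fintype (Hist S M n)
  | 0 => inferInstanceAs (Fintype (S 0))
  | n + 1 =>
    haveI := Hist.instFintype S M n
    inferInstanceAs (Fintype (Hist S M n × (S (n + 1) × M (n + 1))))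

/-! ### Processes with classical memory -/

open scoped Classical in
/-- The data of a classical-memory process with `N` gates: an ensemble of initial states,
instruments (given by the Choi matrices of their completely positive maps `O n → I (n + 1)`), and
the conditional probabilities `p(sₙ₊₁ | s₀, s₁, m₁, …, sₙ, mₙ)` with which the settings are chosen. -/
structure ClassicalMemory (I O S M : ℕ → Type) [∀ n, Fintype (I n)] [∀ n, Fintype (O n)]
    [∀ n, Fintype (S n)] [∀ n, Fintype (M n)] (N : ℕ) where
  /-- the distribution `p(s₀)` -/
  p₀ : S 0 → ℝ
  p₀_nonneg : ∀ s, 0 ≤ p₀ s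
  p₀_sum : ∑ s, p₀ s = 1
  /-- the initial states `ρ_{s₀}` -/
  ρ : S 0 → Matrix (I 0) (I 0) ℂ
  ρ_posSemidef : ∀ s, (ρ s).PosSemidef
  ρ_trace : ∀ s, (ρ s).trace = 1
  /-- the conditional distributions of the next setting given the record so far -/
  p : ∀ n, Hist S M n → S (n + 1) → ℝ
  p_nonneg : ∀ n < N, ∀ h s, 0 ≤ p n h s
  p_sum : ∀ n < N, ∀ h, ∑ s, p n h s = 1
  /-- `T n s m`: Choi matrix of the map of outcome `m` of the instrument with setting `s` -/
  T : ∀ n, S (n + 1) → M (n + 1) → Matrix (O n × I (n + 1)) (O n × I (n + 1)) ℂ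
  T_posSemidef : ∀ n < N, ∀ s m, (T n s m).PosSemidef
  /-- the maps of an instrument sum to a trace-preserving one: `Tr_I ∑ₘ T n s m = 1` on `O n` -/
  T_tracePreserving : ∀ n < N, ∀ s, ∀ o o' : O n,
    ∑ m, ∑ i, T n s m (o, i) (o', i) = if o = o' then 1 else 0

namespace ClassicalMemory

variable {I O S M : ℕ → Type} [∀ n, Fintype (I n)] [∀ n, Fintype (O n)]
  [∀ n, Fintype (S n)] [∀ n, Fintype (M n)] {N : ℕ}

/-- The summand
`p(s₀) ρ_{s₀} ⊗ p(s₁|s₀) T_{m₁|s₁} ⊗ ⋯ ⊗ p(sₙ|s₀,…,sₙ₋₁,m₁,…,mₙ₋₁) T_{mₙ|sₙ}` of a record. -/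
noncomputable def term (D : ClassicalMemory I O S M N) :
    ∀ n, Hist S M n → Matrix (Sites I O n) (Sites I O n) ℂ
  | 0, s => (D.p₀ s : ℂ) • D.ρ s
  | n + 1, (h, s, m) => D.term n h ⊗ₖ ((D.p n h s : ℂ) • D.T n s m)

/-- The process matrix `W_CM`: the sum over all settings and outcomes. -/
noncomputable def processMatrix (D : ClassicalMemory I O S M N) :
    Matrix (Sites I O N) (Sites I O N) ℂ :=
  ∑ h : Hist S M N, D.term N h

end ClassicalMemory

/-- `W` is a process matrix with `N` gates and classical memory. -/
def IsClassicalMemory (I O : ℕ → Type) [∀ n, Fintype (I n)] [∀ n, Fintype (O n)] (N : ℕ)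
    (W : Matrix (Sites I O N) (Sites I O N) ℂ) : Prop :=
  ∃ (S M : ℕ → Type) (_ : ∀ n, Fintype (S n)) (_ : ∀ n, Fintype (M n))
    (_ : ∀ n, Nonempty (S n)) (_ : ∀ n, Nonempty (M n)) (D : ClassicalMemory I O S M N),
    D.processMatrix = W

/-! ### Choi matrices, link product, measurements -/

/-- `|V⟫⟪V|` for `V : ℂ^A → ℂ^B`, where `|V⟫ = ∑ₐ |a⟩ ⊗ V|a⟩`. -/
def choi {A B : Type} (V : Matrix B A ℂ) : Matrix (A × B) (A × B) ℂ :=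
  Matrix.of fun x y => V x.2 x.1 * star (V y.2 y.1)

/-- The link product `P * Q = Tr_E[(P^{T_E} ⊗ 1_B)(1_A ⊗ Q)]` over the shared space `E`, in
coordinates. -/
def link {A E B : Type} [Fintype E] (P : Matrix (A × E) (A × E) ℂ)
    (Q : Matrix (E × B) (E × B) ℂ) : Matrix (A × B) (A × B) ℂ :=
  Matrix.of fun x y => ∑ e, ∑ f, P (x.1, e) (y.1, f) * Q (e, x.2) (f, y.2)

open scoped Classical in
/-- Projective measurement of `E` in the fixed basis, with the result forgotten:
`P ↦ ∑_q (1 ⊗ Π_q) P (1 ⊗ Π_q)`, where `q` runs through the classes of `r` and `Π_q` is the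
projection on the span of the basis vectors in `q`. If all basis vectors are equivalent, nothing is
measured. -/
noncomputable def measure {A E : Type} (r : Setoid E) (P : Matrix (A × E) (A × E) ℂ) :
    Matrix (A × E) (A × E) ℂ :=
  Matrix.of fun x y => if r x.2 y.2 then P x y else 0

/-! ### Circuits of nested controlled unitaries -/

/-- Basis labels of the environment after `n` gates: a control register `S 0`, and for each gate
`k = 1, …, n` a control register `S k`, an outcome register `M k`, and a register `K k` that is not
used again. -/
def Env (S M K : ℕ → Type) : ℕ → Type
  | 0 => S 0
  | n + 1 => Env S M K n × (S (n + 1) × (M (n + 1) × K (n + 1)))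

instance Env.instFintype (S M K : ℕ → Type) [∀ n, Fintype (S n)] [∀ n, Fintype (M n)]
    [∀ n, Fintype (K n)] : ∀ n, Fintype (Env S M K n)
  | 0 => inferInstanceAs (Fintype (S 0))
  | n + 1 =>
    haveI := Env.instFintype S M K n
    inferInstanceAs (Fintype (Env S M K n × (S (n + 1) × (M (n + 1) × K (n + 1)))))

/-- The part of an environment basis label that later gates may be controlled by. -/
def Env.hist {S M K : ℕ → Type} : ∀ {n}, Env S M K n → Hist S M n
  | 0, s => s
  | _ + 1, (e, s, m, _) => (Env.hist e, s, m)

open scoped Classical in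
/-- A circuit with `N` gates. It starts in an arbitrary joint state of the system and the register
`S 0`. At gate `n` two fresh environment registers `S (n + 1)` and `X (n + 1)` are supplied in the
basis states `zS n` and `zX n`; first `S (n + 1)` is rotated by `R n h`, controlled by the basis state
`h` of the earlier control and outcome registers; then `U n h s`, controlled by `h` and by the basis
state `s` of `S (n + 1)`, acts on the system and `X (n + 1)`, whose space is split into `M (n + 1)` and
`K (n + 1)` afterwards. -/
structure Circuit (I O S M K X : ℕ → Type) [∀ n, Fintype (I n)] [∀ n, Fintype (O n)]
    [∀ n, Fintype (S n)] [∀ n, Fintype (M n)] [∀ n, Fintype (K n)] [∀ n, Fintype (X n)]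
    (N : ℕ) where
  init : Matrix (I 0 × S 0) (I 0 × S 0) ℂ
  init_posSemidef : init.PosSemidef
  init_trace : init.trace = 1
  zS : ∀ n, S (n + 1)
  zX : ∀ n, X (n + 1)
  R : ∀ n, Hist S M n → Matrix (S (n + 1)) (S (n + 1)) ℂ
  R_isometry : ∀ n < N, ∀ h, (R n h).conjTranspose * R n h = 1
  R_coisometry : ∀ n < N, ∀ h, R n h * (R n h).conjTranspose = 1
  U : ∀ n, Hist S M n → S (n + 1) →
    Matrix (I (n + 1) × (M (n + 1) × K (n + 1))) (O n × X (n + 1)) ℂ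
  U_isometry : ∀ n < N, ∀ h s, (U n h s).conjTranspose * U n h s = 1
  U_coisometry : ∀ n < N, ∀ h s, U n h s * (U n h s).conjTranspose = 1

namespace Circuit

variable {I O S M K X : ℕ → Type} [∀ n, Fintype (I n)] [∀ n, Fintype (O n)]
  [∀ n, Fintype (S n)] [∀ n, Fintype (M n)] [∀ n, Fintype (K n)] [∀ n, Fintype (X n)] {N : ℕ}

open scoped Classical in
/-- `∑ₑ |e⟩⟨e| ⊗ R n (hist e)` on the old environment and the fresh register `S (n + 1)`. -/
noncomputable def controlledRotation (C : Circuit I O S M K X N) (n : ℕ) :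
    Matrix (Env S M K n × S (n + 1)) (Env S M K n × S (n + 1)) ℂ :=
  (Matrix.blockDiagonal fun e : Env S M K n => C.R n e.hist).submatrix Prod.swap Prod.swap

open scoped Classical in
/-- `∑_{e,s} U n (hist e) s ⊗ |e,s⟩⟨e,s|`. -/
noncomputable def controlledUnitary (C : Circuit I O S M K X N) (n : ℕ) :
    Matrix ((I (n + 1) × (M (n + 1) × K (n + 1))) × (Env S M K n × S (n + 1)))
      ((O n × X (n + 1)) × (Env S M K n × S (n + 1))) ℂ :=
  Matrix.blockDiagonal fun c : Env S M K n × S (n + 1) => C.U n c.1.hist c.2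

open scoped Classical in
/-- The whole system-environment interaction at gate `n`: the controlled rotation followed by the
controlled unitary, with the tensor factors put in order. -/
noncomputable def gate (C : Circuit I O S M K X N) (n : ℕ) :
    Matrix (I (n + 1) × Env S M K (n + 1))
      (O n × (Env S M K n × (S (n + 1) × X (n + 1)))) ℂ :=
  (C.controlledUnitary n *
      ((1 : Matrix (O n × X (n + 1)) (O n × X (n + 1)) ℂ) ⊗ₖ C.controlledRotation n)).submatrix
    (fun x : I (n + 1) × (Env S M K n × (S (n + 1) × (M (n + 1) × K (n + 1)))) =>
      ((x.1, x.2.2.2), (x.2.1, x.2.2.1)))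
    (fun y => ((y.1, y.2.2.2), (y.2.1, y.2.2.1)))

/-- The Choi matrix of `gate n`, with the incoming environment as first tensor factor and the
outgoing one as last. -/
noncomputable def gateChoi (C : Circuit I O S M K X N) (n : ℕ) :
    Matrix ((Env S M K n × (S (n + 1) × X (n + 1))) × ((O n × I (n + 1)) × Env S M K (n + 1)))
      ((Env S M K n × (S (n + 1) × X (n + 1))) × ((O n × I (n + 1)) × Env S M K (n + 1))) ℂ :=
  (choi (C.gate n)).submatrix
    (fun x => ((x.2.1.1, x.1), (x.2.1.2, x.2.2))) (fun x => ((x.2.1.1, x.1), (x.2.1.2, x.2.2)))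

open scoped Classical in
/-- The Choi matrix of the circuit up to gate `n`, with the environment still present. After the
preparation (`n = 0`) and after each gate the environment undergoes the measurement `r n`. -/
noncomputable def openComb (C : Circuit I O S M K X N) (r : ∀ n, Setoid (Env S M K n)) :
    ∀ n, Matrix (Sites I O n × Env S M K n) (Sites I O n × Env S M K n) ℂ
  | 0 => measure (A := I 0) (E := S 0) (r 0) C.init
  | n + 1 =>
    measure (A := Sites I O n × (O n × I (n + 1))) (r (n + 1))
      ((link
        ((C.openComb r n ⊗ₖ
            Matrix.single (C.zS n, C.zX n) (C.zS n, C.zX n) (1 : ℂ)).submatrix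
          (Equiv.prodAssoc _ _ _).symm (Equiv.prodAssoc _ _ _).symm)
        (C.gateChoi n)).submatrix (Equiv.prodAssoc _ _ _) (Equiv.prodAssoc _ _ _))

/-- The process matrix of the circuit: the environment is traced out after the last gate. -/
noncomputable def processMatrix (C : Circuit I O S M K X N) (r : ∀ n, Setoid (Env S M K n)) :
    Matrix (Sites I O N) (Sites I O N) ℂ :=
  Matrix.of fun x y => ∑ e : Env S M K N, C.openComb r N (x, e) (y, e)

open scoped Classical in
/-- The circuit `C` is the one that belongs to the classical-memory data `D`. -/
structure Realizes (C : Circuit I O S M K X N) (D : ClassicalMemory I O S M N) : Prop where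
  /-- the initial state is `∑ₛ p(s) ρ_s ⊗ |s⟩⟨s|` -/
  init_eq : C.init = ∑ s, ((D.p₀ s : ℂ) • D.ρ s) ⊗ₖ Matrix.single s s (1 : ℂ)
  /-- the rotation maps the fresh basis state to `∑ₛ √p(s|h) |s⟩` -/
  R_eq : ∀ n < N, ∀ h s, C.R n h s (C.zS n) = (Real.sqrt (D.p n h s) : ℂ)
  /-- the unitary on the system is controlled by the register `S (n + 1)` alone -/
  U_setting : ∀ n < N, ∀ h h' s, C.U n h s = C.U n h' s
  /-- `U n h s`, applied to the fresh register and followed by the projection `1 ⊗ |m⟩⟨m|` and the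
  trace over the registers, is the map of outcome `m` of the instrument with setting `s` -/
  U_dilates : ∀ n < N, ∀ h s m, ∀ o o' : O n, ∀ i i' : I (n + 1),
    ∑ k, C.U n h s (i, m, k) (o, C.zX n) * star (C.U n h s (i', m, k) (o', C.zX n)) =
      D.T n s m (o, i) (o', i')

end Circuit

/-- `W` is the process matrix of some circuit of nested controlled unitaries with `N` gates, with
some choice of measurements on the environment. -/
def IsCircuitProcess (I O : ℕ → Type) [∀ n, Fintype (I n)] [∀ n, Fintype (O n)] (N : ℕ)
    (W : Matrix (Sites I O N) (Sites I O N) ℂ) : Prop :=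
  ∃ (S M K X : ℕ → Type) (_ : ∀ n, Fintype (S n)) (_ : ∀ n, Fintype (M n))
    (_ : ∀ n, Fintype (K n)) (_ : ∀ n, Fintype (X n))
    (_ : ∀ n, Nonempty (S n)) (_ : ∀ n, Nonempty (M n))
    (C : Circuit I O S M K X N) (r : ∀ n, Setoid (Env S M K n)), C.processMatrix r = W

end ClassicalMemoryProcess

namespace ClassicalMemoryProcess

/-! ### Completing isometries to unitaries -/

open scoped Classical in
/-- Orthonormal columns indexed by a set `s` extend to a unitary matrix. -/
theorem exists_unitary_extending_columns {A B : Type} [Fintype A] [Fintype B]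
    (hcard : Fintype.card B = Fintype.card A) (v : A → B → ℂ) (s : Set A)
    (hv : ∀ a ∈ s, ∀ a' ∈ s, ∑ b, star (v a b) * v a' b = if a = a' then 1 else 0) :
    ∃ U : Matrix B A ℂ, U.conjTranspose * U = 1 ∧ U * U.conjTranspose = 1 ∧
      ∀ a ∈ s, ∀ b, U b a = v a b := by
  have hon : Orthonormal ℂ (s.domRestrict fun a => WithLp.toLp 2 (v a)) := by
    rw [orthonormal_iff_ite]
    rintro ⟨a, ha⟩ ⟨a', ha'⟩
    simpa [PiLp.inner_apply, mul_comm, Set.domRestrict_apply] using hv a ha a' ha'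
  obtain ⟨b, hb⟩ := hon.exists_orthonormalBasis_extension_of_card_eq
    (by rw [finrank_euclideanSpace, hcard])
  have hU : (Matrix.of fun x a => b a x).conjTranspose * (Matrix.of fun x a => b a x) = 1 := by
    ext a a'
    have := orthonormal_iff_ite.mp b.orthonormal a a'
    simpa [Matrix.mul_apply, PiLp.inner_apply, Matrix.one_apply, mul_comm] using this
  refine ⟨Matrix.of fun x a => b a x, hU, ?_, fun a ha x => ?_⟩
  · exact (Matrix.mul_eq_one_comm_of_card_eq (m := A) (n := B) (R := ℂ) hcard.symm).mp hU
  · simp [hb a ha]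

/-- A probability distribution is encoded in the column `z` of a unitary matrix. -/
theorem exists_rotation {A : Type} [Fintype A] [DecidableEq A] (z : A) (p : A → ℝ)
    (hp : ∀ a, 0 ≤ p a) (hsum : ∑ a, p a = 1) :
    ∃ R : Matrix A A ℂ, R.conjTranspose * R = 1 ∧ R * R.conjTranspose = 1 ∧
      ∀ a, R a z = (Real.sqrt (p a) : ℂ) := by
  obtain ⟨R, h₁, h₂, h₃⟩ := exists_unitary_extending_columns (A := A) (B := A) rfl
    (fun _ a => (Real.sqrt (p a) : ℂ)) {z} (by
      rintro a rfl a' rfl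
      have : ∀ b, star (Real.sqrt (p b) : ℂ) * (Real.sqrt (p b) : ℂ) = (p b : ℂ) := fun b => by
        simp [← Complex.ofReal_mul, Real.mul_self_sqrt (hp b)]
      simp only [this, if_true]
      exact_mod_cast hsum)
  exact ⟨R, by convert h₁, by convert h₂, fun a => h₃ z rfl a⟩

open scoped MatrixOrder in
/-- Stinespring dilation of an instrument: the maps with Choi matrices `T m` are obtained from one
unitary acting on the system and a fresh register in the basis state `z`, by projecting a register
`M` on `m` and tracing out. -/
theorem exists_instrument_dilation {O I M : Type} [Fintype O] [Fintype I] [Fintype M]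
    [DecidableEq O] [DecidableEq I] [DecidableEq M] (z : I × (M × I))
    (T : M → Matrix (O × I) (O × I) ℂ) (hT : ∀ m, (T m).PosSemidef)
    (htp : ∀ o o', ∑ m, ∑ i, T m (o, i) (o', i) = if o = o' then 1 else 0) :
    ∃ U : Matrix (I × (M × (O × I))) (O × (I × (M × I))) ℂ,
      U.conjTranspose * U = 1 ∧ U * U.conjTranspose = 1 ∧
      ∀ m o o' i i', ∑ k, U (i, m, k) (o, z) * star (U (i', m, k) (o', z)) =
        T m (o, i) (o', i') := by
  have hfac : ∀ m, ∃ B : Matrix (O × I) (O × I) ℂ, T m = B * B.conjTranspose := fun m => by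
    obtain ⟨B, hB⟩ := CStarAlgebra.nonneg_iff_eq_star_mul_self.mp (hT m).nonneg
    exact ⟨B.conjTranspose, by simpa [Matrix.star_eq_conjTranspose] using hB⟩
  choose Q hQ using hfac
  have hQ' : ∀ m q q', ∑ k, Q m q k * star (Q m q' k) = T m q q' := fun m q q' => by
    rw [hQ m]; simp [Matrix.mul_apply]
  obtain ⟨U, h₁, h₂, h₃⟩ := exists_unitary_extending_columns
    (A := O × (I × (M × I))) (B := I × (M × (O × I)))
    (by simp only [Fintype.card_prod]; ring)
    (fun a b => Q b.2.1 (a.1, b.1) b.2.2) {a | a.2 = z} (by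
      rintro ⟨o, _⟩ rfl ⟨o', _⟩ rfl
      have := htp o' o
      simp only [Prod.mk.injEq, and_true, eq_comm (a := o)]
      rw [Finset.sum_comm] at this
      convert this using 1
      rw [Fintype.sum_prod_type]
      refine Finset.sum_congr rfl fun i _ => ?_
      rw [Fintype.sum_prod_type]
      refine Finset.sum_congr rfl fun m _ => ?_
      rw [← hQ']
      exact Finset.sum_congr rfl fun k _ => mul_comm _ _)
  refine ⟨U, by convert h₁, by convert h₂, fun m o o' i i' => ?_⟩
  rw [← hQ']
  refine Finset.sum_congr rfl fun k _ => ?_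
  rw [h₃ (o, z) rfl, h₃ (o', z) rfl]

namespace Circuit

variable {I O S M K X : ℕ → Type} [∀ n, Fintype (I n)] [∀ n, Fintype (O n)]
  [∀ n, Fintype (S n)] [∀ n, Fintype (M n)] [∀ n, Fintype (K n)] [∀ n, Fintype (X n)] {N : ℕ}

/-! ### Unitarity of the gates -/

open scoped Classical in
theorem controlledRotation_isometry (C : Circuit I O S M K X N) {n : ℕ} (hn : n < N) :
    (C.controlledRotation n).conjTranspose * C.controlledRotation n = 1 := by
  have hsw : (Prod.swap : Env S M K n × S (n + 1) → _) = Equiv.prodComm _ _ := rfl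
  unfold controlledRotation
  rw [Matrix.conjTranspose_submatrix, hsw, Matrix.submatrix_mul_equiv,
    Matrix.blockDiagonal_conjTranspose, ← Matrix.blockDiagonal_mul]
  simp only [C.R_isometry n hn]
  ext a b
  simp [Matrix.blockDiagonal_apply, Matrix.one_apply, Prod.ext_iff]
  grind

open scoped Classical in
theorem controlledRotation_coisometry (C : Circuit I O S M K X N) {n : ℕ} (hn : n < N) :
    C.controlledRotation n * (C.controlledRotation n).conjTranspose = 1 :=
  mul_eq_one_comm.mp (C.controlledRotation_isometry hn)

open scoped Classical in
theorem controlledUnitary_isometry (C : Circuit I O S M K X N) {n : ℕ} (hn : n < N) :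
    (C.controlledUnitary n).conjTranspose * C.controlledUnitary n = 1 := by
  unfold controlledUnitary
  rw [Matrix.blockDiagonal_conjTranspose, ← Matrix.blockDiagonal_mul]
  simp only [C.U_isometry n hn]
  ext a b
  simp [Matrix.blockDiagonal_apply, Matrix.one_apply, Prod.ext_iff]
  grind

open scoped Classical in
theorem controlledUnitary_coisometry (C : Circuit I O S M K X N) {n : ℕ} (hn : n < N) :
    C.controlledUnitary n * (C.controlledUnitary n).conjTranspose = 1 := by
  unfold controlledUnitary
  rw [Matrix.blockDiagonal_conjTranspose, ← Matrix.blockDiagonal_mul]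
  simp only [C.U_coisometry n hn]
  ext a b
  simp [Matrix.blockDiagonal_apply, Matrix.one_apply, Prod.ext_iff]
  grind

/-- Reordering of the tensor factors of the outgoing space of a gate. -/
def outEquiv (I S M K : ℕ → Type) (n : ℕ) :
    I (n + 1) × Env S M K (n + 1) ≃
      (I (n + 1) × (M (n + 1) × K (n + 1))) × (Env S M K n × S (n + 1)) where
  toFun := fun x : I (n + 1) × (Env S M K n × (S (n + 1) × (M (n + 1) × K (n + 1)))) =>
    ((x.1, x.2.2.2), (x.2.1, x.2.2.1))
  invFun := fun y => (y.1.1, (y.2.1, (y.2.2, y.1.2)))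
  left_inv := fun _ => rfl
  right_inv := fun _ => rfl

/-- Reordering of the tensor factors of the incoming space of a gate. -/
def inEquiv (O S M K X : ℕ → Type) (n : ℕ) :
    O n × (Env S M K n × (S (n + 1) × X (n + 1))) ≃
      (O n × X (n + 1)) × (Env S M K n × S (n + 1)) where
  toFun := fun y => ((y.1, y.2.2.2), (y.2.1, y.2.2.1))
  invFun := fun y => (y.1.1, (y.2.1, (y.2.2, y.1.2)))
  left_inv := fun _ => rfl
  right_inv := fun _ => rfl

open scoped Classical in
theorem gate_eq_submatrix (C : Circuit I O S M K X N) (n : ℕ) :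
    C.gate n = (C.controlledUnitary n *
      ((1 : Matrix (O n × X (n + 1)) (O n × X (n + 1)) ℂ) ⊗ₖ C.controlledRotation n)).submatrix
        (outEquiv I S M K n) (inEquiv O S M K X n) := rfl

open scoped Classical in
theorem gate_isometry (C : Circuit I O S M K X N) {n : ℕ} (hn : n < N) :
    (C.gate n).conjTranspose * C.gate n = 1 := by
  rw [gate_eq_submatrix, Matrix.conjTranspose_submatrix, Matrix.submatrix_mul_equiv,
    Matrix.conjTranspose_mul, Matrix.mul_assoc, ← Matrix.mul_assoc _ (C.controlledUnitary n),
    C.controlledUnitary_isometry hn, Matrix.one_mul, Matrix.conjTranspose_kronecker,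
    ← Matrix.mul_kronecker_mul, C.controlledRotation_isometry hn]
  simp

open scoped Classical in
theorem gate_coisometry (C : Circuit I O S M K X N) {n : ℕ} (hn : n < N) :
    C.gate n * (C.gate n).conjTranspose = 1 := by
  rw [gate_eq_submatrix, Matrix.conjTranspose_submatrix, Matrix.submatrix_mul_equiv,
    Matrix.conjTranspose_mul, Matrix.mul_assoc,
    ← Matrix.mul_assoc _ _ (C.controlledUnitary n).conjTranspose, Matrix.conjTranspose_kronecker,
    ← Matrix.mul_kronecker_mul, C.controlledRotation_coisometry hn]
  simp [C.controlledUnitary_coisometry hn]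

/-! ### The branches of a circuit -/

open scoped Classical in
theorem gate_apply (C : Circuit I O S M K X N) (n : ℕ) (i : I (n + 1)) (e e' : Env S M K n)
    (s s' : S (n + 1)) (m : M (n + 1)) (k : K (n + 1)) (o : O n) (x : X (n + 1)) :
    C.gate n (i, (e, s, m, k)) (o, (e', s', x)) =
      if e = e' then C.U n e.hist s (i, m, k) (o, x) * C.R n e.hist s s' else 0 := by
  change (C.controlledUnitary n * ((1 : Matrix (O n × X (n + 1)) (O n × X (n + 1)) ℂ) ⊗ₖ
    C.controlledRotation n)) ((i, m, k), (e, s)) ((o, x), (e', s')) = _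
  rw [Matrix.mul_apply, Finset.sum_eq_single ((o, x), (e, s))]
  · by_cases h : e = e' <;>
      simp [controlledUnitary, controlledRotation, Matrix.blockDiagonal_apply, h]
  · rintro ⟨q, c⟩ - hne
    by_cases hc : (e, s) = c
    · have hq : q ≠ (o, x) := fun hq => hne (by rw [hq, hc])
      simp [Matrix.one_apply_ne hq]
    · simp [controlledUnitary, Matrix.blockDiagonal_apply, hc]
  · simp

/-- Tracing out the environment leaves the diagonal blocks, on which measurements in the fixed
basis have no effect. -/
theorem openComb_succ_diag (C : Circuit I O S M K X N) (r : ∀ n, Setoid (Env S M K n)) (n : ℕ)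
    (x y : Sites I O n) (o o' : O n) (i i' : I (n + 1)) (e : Env S M K n) (s : S (n + 1))
    (m : M (n + 1)) (k : K (n + 1)) :
    C.openComb r (n + 1) ((x, (o, i)), (e, s, m, k)) ((y, (o', i')), (e, s, m, k)) =
      C.openComb r n (x, e) (y, e) *
        ((C.U n e.hist s (i, m, k) (o, C.zX n) * C.R n e.hist s (C.zS n)) *
          star (C.U n e.hist s (i', m, k) (o', C.zX n) * C.R n e.hist s (C.zS n))) := by
  classical
  have hgate : ∀ q q' : Env S M K n × (S (n + 1) × X (n + 1)),
      C.gateChoi n (q, ((o, i), (e, s, m, k))) (q', ((o', i'), (e, s, m, k))) =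
        C.gate n (i, (e, s, m, k)) (o, q) * star (C.gate n (i', (e, s, m, k)) (o', q')) :=
    fun _ _ => rfl
  have hcomb : C.openComb r (n + 1) ((x, (o, i)), (e, s, m, k)) ((y, (o', i')), (e, s, m, k)) =
      ∑ q : Env S M K n × (S (n + 1) × X (n + 1)), ∑ q' : Env S M K n × (S (n + 1) × X (n + 1)),
        (C.openComb r n (x, q.1) (y, q'.1) *
          Matrix.single (C.zS n, C.zX n) (C.zS n, C.zX n) (1 : ℂ) q.2 q'.2) *
        C.gateChoi n (q, ((o, i), (e, s, m, k))) (q', ((o', i'), (e, s, m, k))) := by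
    rw [openComb]
    refine (if_pos ((r (n + 1)).refl _)).trans ?_
    simp only [link]
    rfl
  rw [hcomb, Finset.sum_eq_single (e, (C.zS n, C.zX n)),
    Finset.sum_eq_single (e, (C.zS n, C.zX n))]
  · simp [hgate, gate_apply]
  · rintro ⟨f, s', x'⟩ - hne
    by_cases hf : e = f
    · have hq : (C.zS n, C.zX n) ≠ (s', x') := fun hq => hne (by rw [hq, hf])
      rw [Matrix.single_apply_of_col_ne _ _ hq]
      simp
    · simp [hgate, gate_apply, hf]
  · simp
  · rintro ⟨f, s', x'⟩ - hne
    refine Finset.sum_eq_zero fun q' _ => ?_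
    by_cases hf : e = f
    · have hq : (C.zS n, C.zX n) ≠ (s', x') := fun hq => hne (by rw [hq, hf])
      rw [Matrix.single_apply_of_row_ne hq]
      simp
    · simp [hgate, gate_apply, hf]
  · simp

/-- The probability with which the setting `s` occurs after the record `h`. -/
noncomputable def weight (C : Circuit I O S M K X N) (n : ℕ) (h : Hist S M n) (s : S (n + 1)) : ℝ :=
  Complex.normSq (C.R n h s (C.zS n))

/-- The Choi matrix of `σ ↦ Tr_{MK} [(1 ⊗ |m⟩⟨m|) U (σ ⊗ |0⟩⟨0|) U†]` for `U = U n h s`. -/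
noncomputable def effect (C : Circuit I O S M K X N) (n : ℕ) (h : Hist S M n) (s : S (n + 1))
    (m : M (n + 1)) : Matrix (O n × I (n + 1)) (O n × I (n + 1)) ℂ :=
  Matrix.of fun q q' => ∑ k, C.U n h s (q.2, m, k) (q.1, C.zX n) *
    star (C.U n h s (q'.2, m, k) (q'.1, C.zX n))

/-- The contribution of the record `h` to the process matrix of a circuit. -/
noncomputable def branch (C : Circuit I O S M K X N) :
    ∀ n, Hist S M n → Matrix (Sites I O n) (Sites I O n) ℂ
  | 0, s => Matrix.of fun x y => C.init (x, s) (y, s)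
  | n + 1, (h, s, m) => C.branch n h ⊗ₖ ((C.weight n h s : ℂ) • C.effect n h s m)

theorem sum_openComb_diag (C : Circuit I O S M K X N) (r : ∀ n, Setoid (Env S M K n)) (n : ℕ)
    (f : Hist S M n → ℂ) (x y : Sites I O n) :
    ∑ e : Env S M K n, C.openComb r n (x, e) (y, e) * f e.hist =
      ∑ h : Hist S M n, C.branch n h x y * f h := by
  classical
  induction n with
  | zero =>
    refine Finset.sum_congr rfl fun s _ => ?_
    congr 1
    exact if_pos ((r 0).refl _)
  | succ n ih =>
    obtain ⟨x, o, i⟩ := x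
    obtain ⟨y, o', i'⟩ := y
    have hl : ∑ e : Env S M K (n + 1), C.openComb r (n + 1) ((x, (o, i)), e) ((y, (o', i')), e) *
        f e.hist = ∑ e : Env S M K n, C.openComb r n (x, e) (y, e) *
          ∑ s, ∑ m, C.weight n e.hist s * C.effect n e.hist s m (o, i) (o', i') *
            f (e.hist, s, m) := by
      refine (Fintype.sum_prod_type (γ := ℂ) (α₁ := Env S M K n)
        (α₂ := S (n + 1) × (M (n + 1) × K (n + 1))) _).trans ?_
      refine Finset.sum_congr rfl fun e _ => ?_
      rw [Fintype.sum_prod_type, Finset.mul_sum]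
      refine Finset.sum_congr rfl fun s _ => ?_
      rw [Fintype.sum_prod_type, Finset.mul_sum]
      refine Finset.sum_congr rfl fun m _ => ?_
      simp only [effect, Matrix.of_apply, Finset.mul_sum, Finset.sum_mul]
      refine Finset.sum_congr rfl fun k _ => ?_
      rw [openComb_succ_diag, weight, Complex.normSq_eq_conj_mul_self]
      simp only [star_mul', Env.hist]
      rw [← starRingEnd_apply (C.R n _ _ _)]
      ring
    have hr : ∑ h : Hist S M (n + 1), C.branch (n + 1) h (x, (o, i)) (y, (o', i')) * f h =
        ∑ h : Hist S M n, C.branch n h x y *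
          ∑ s, ∑ m, C.weight n h s * C.effect n h s m (o, i) (o', i') * f (h, s, m) := by
      refine (Fintype.sum_prod_type (γ := ℂ) (α₁ := Hist S M n)
        (α₂ := S (n + 1) × M (n + 1)) _).trans ?_
      refine Finset.sum_congr rfl fun h _ => ?_
      rw [Fintype.sum_prod_type, Finset.mul_sum]
      refine Finset.sum_congr rfl fun s _ => ?_
      rw [Finset.mul_sum]
      refine Finset.sum_congr rfl fun m _ => ?_
      rw [← mul_assoc]
      rfl
    rw [hl, hr, ← ih]

theorem processMatrix_eq_sum_branch (C : Circuit I O S M K X N)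
    (r : ∀ n, Setoid (Env S M K n)) : C.processMatrix r = ∑ h, C.branch N h := by
  ext x y
  simpa [Matrix.sum_apply, processMatrix] using C.sum_openComb_diag r N (fun _ => 1) x y

end Circuit

/-! ### From classical memory to circuits -/

section Realization

variable {I O S M K X : ℕ → Type} [∀ n, Fintype (I n)] [∀ n, Fintype (O n)]
  [∀ n, Fintype (S n)] [∀ n, Fintype (M n)] [∀ n, Fintype (K n)] [∀ n, Fintype (X n)] {N : ℕ}

theorem Circuit.Realizes.branch_eq_term {C : Circuit I O S M K X N} {D : ClassicalMemory I O S M N}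
    (hCD : C.Realizes D) : ∀ n ≤ N, ∀ h, C.branch n h = D.term n h
  | 0, _, s => by
    classical
    suffices key : ∀ (s : S 0) (x y : I 0), C.init (x, s) (y, s) = ((D.p₀ s : ℂ) • D.ρ s) x y from
      Matrix.ext (key s)
    intro s x y
    rw [hCD.init_eq, Matrix.sum_apply, Finset.sum_eq_single s]
    · simp
    · intro s' _ hs'
      simp [hs']
    · simp
  | n + 1, hn, (h, s, m) => by
    have hw : C.weight n h s = D.p n h s := by
      rw [Circuit.weight, hCD.R_eq n hn h s, Complex.normSq_ofReal,
        Real.mul_self_sqrt (D.p_nonneg n hn h s)]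
    have he : C.effect n h s m = D.T n s m := by
      ext ⟨o, i⟩ ⟨o', i'⟩
      exact hCD.U_dilates n hn h s m o o' i i'
    rw [Circuit.branch, ClassicalMemory.term, hw, he, hCD.branch_eq_term n (Nat.le_of_succ_le hn) h]

theorem Circuit.Realizes.processMatrix_eq {C : Circuit I O S M K X N}
    {D : ClassicalMemory I O S M N} (hCD : C.Realizes D) (r : ∀ n, Setoid (Env S M K n)) :
    C.processMatrix r = D.processMatrix := by
  rw [Circuit.processMatrix_eq_sum_branch, ClassicalMemory.processMatrix]
  exact Finset.sum_congr rfl fun h _ => hCD.branch_eq_term N le_rfl h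

open scoped Classical in
theorem ClassicalMemory.exists_circuit_realizes [∀ n, Nonempty (I n)] [∀ n, Nonempty (S n)]
    [∀ n, Nonempty (M n)] (D : ClassicalMemory I O S M N) :
    ∃ C : Circuit I O S M (fun n => O (n - 1) × I n) (fun n => I n × (M n × I n)) N,
      C.Realizes D := by
  let zS : ∀ n, S (n + 1) := fun _ => Classical.arbitrary _
  let zX : ∀ n, I (n + 1) × (M (n + 1) × I (n + 1)) := fun _ => Classical.arbitrary _
  have hR : ∀ n (h : Hist S M n), ∃ R : Matrix (S (n + 1)) (S (n + 1)) ℂ, n < N →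
      R.conjTranspose * R = 1 ∧ R * R.conjTranspose = 1 ∧
        ∀ s, R s (zS n) = (Real.sqrt (D.p n h s) : ℂ) := fun n h => by
    by_cases hn : n < N
    · obtain ⟨R, hR⟩ := exists_rotation (zS n) (D.p n h) (D.p_nonneg n hn h) (D.p_sum n hn h)
      exact ⟨R, fun _ => hR⟩
    · exact ⟨0, fun h => absurd h hn⟩
  have hU : ∀ n (s : S (n + 1)),
      ∃ U : Matrix (I (n + 1) × (M (n + 1) × (O n × I (n + 1))))
        (O n × (I (n + 1) × (M (n + 1) × I (n + 1)))) ℂ, n < N →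
      U.conjTranspose * U = 1 ∧ U * U.conjTranspose = 1 ∧
      ∀ m o o' i i', ∑ k, U (i, m, k) (o, zX n) * star (U (i', m, k) (o', zX n)) =
        D.T n s m (o, i) (o', i') := fun n s => by
    by_cases hn : n < N
    · obtain ⟨U, hU⟩ := exists_instrument_dilation (zX n) (D.T n s) (D.T_posSemidef n hn s)
        (D.T_tracePreserving n hn s)
      exact ⟨U, fun _ => hU⟩
    · exact ⟨0, fun h => absurd h hn⟩
  choose R hR using hR
  choose U hU using hU
  refine ⟨{ init := ∑ s, ((D.p₀ s : ℂ) • D.ρ s) ⊗ₖ Matrix.single s s (1 : ℂ)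
            init_posSemidef := ?_
            init_trace := ?_
            zS := zS
            zX := zX
            R := R
            R_isometry := fun n hn h => (hR n h hn).1
            R_coisometry := fun n hn h => (hR n h hn).2.1
            U := fun n _ s => U n s
            U_isometry := fun n hn _ s => by convert (hU n s hn).1
            U_coisometry := fun n hn _ s => by convert (hU n s hn).2.1 <;> rfl }, ?_⟩
  · refine Matrix.posSemidef_sum _ fun s _ => Matrix.PosSemidef.kronecker ?_ ?_
    · exact (D.ρ_posSemidef s).smul (by exact_mod_cast D.p₀_nonneg s)
    · simpa using Matrix.posSemidef_conjTranspose_mul_self (Matrix.single s s (1 : ℂ))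
  · simp only [Matrix.trace_sum, Matrix.trace_kronecker, Matrix.trace_smul, D.ρ_trace]
    simpa using congrArg (fun t : ℝ => (t : ℂ)) D.p₀_sum
  · exact
      { init_eq := rfl
        R_eq := fun n hn h s => (hR n h hn).2.2 s
        U_setting := fun _ _ _ _ _ => rfl
        U_dilates := fun n hn _ s m o o' i i' => (hU n s hn).2.2 m o o' i i' }

end Realization

/-! ### From circuits to classical memory -/

/-- Settings that carry along the record of everything that happened before. -/
def RecordSetting (S M : ℕ → Type) : ℕ → Type
  | 0 => S 0
  | n + 1 => Hist S M n × S (n + 1)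

instance RecordSetting.instFintype (S M : ℕ → Type) [∀ n, Fintype (S n)] [∀ n, Fintype (M n)] :
    ∀ n, Fintype (RecordSetting S M n)
  | 0 => inferInstanceAs (Fintype (S 0))
  | n + 1 => inferInstanceAs (Fintype (Hist S M n × S (n + 1)))

instance Hist.instNonempty (S M : ℕ → Type) [∀ n, Nonempty (S n)] [∀ n, Nonempty (M n)] :
    ∀ n, Nonempty (Hist S M n)
  | 0 => inferInstanceAs (Nonempty (S 0))
  | n + 1 =>
    haveI := Hist.instNonempty S M n
    inferInstanceAs (Nonempty (Hist S M n × (S (n + 1) × M (n + 1))))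

instance RecordSetting.instNonempty (S M : ℕ → Type) [∀ n, Nonempty (S n)]
    [∀ n, Nonempty (M n)] : ∀ n, Nonempty (RecordSetting S M n)
  | 0 => inferInstanceAs (Nonempty (S 0))
  | n + 1 => inferInstanceAs (Nonempty (Hist S M n × S (n + 1)))

/-- Forget the copies of the earlier records. -/
def Hist.forget {S M : ℕ → Type} : ∀ n, Hist (RecordSetting S M) M n → Hist S M n
  | 0, s => s
  | n + 1, (h, (_, s), m) => (Hist.forget n h, s, m)

/-- Store with every setting the record that preceded it. -/
def Hist.store {S M : ℕ → Type} : ∀ n, Hist S M n → Hist (RecordSetting S M) M n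
  | 0, s => s
  | n + 1, (h, s, m) => (Hist.store n h, (h, s), m)

theorem Hist.forget_store {S M : ℕ → Type} :
    ∀ n (h : Hist S M n), Hist.forget n (Hist.store n h) = h
  | 0, _ => rfl
  | n + 1, (h, s, m) => by rw [Hist.store, Hist.forget, Hist.forget_store n h]

namespace Circuit

variable {I O S M K X : ℕ → Type} [∀ n, Fintype (I n)] [∀ n, Fintype (O n)]
  [∀ n, Fintype (S n)] [∀ n, Fintype (M n)] [∀ n, Fintype (K n)] [∀ n, Fintype (X n)] {N : ℕ}

theorem weight_sum (C : Circuit I O S M K X N) {n : ℕ} (hn : n < N) (h : Hist S M n) :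
    ∑ s, C.weight n h s = 1 := by
  classical
  have := congrFun (congrFun (C.R_isometry n hn h) (C.zS n)) (C.zS n)
  rw [Matrix.mul_apply] at this
  have h' : ((∑ s, C.weight n h s : ℝ) : ℂ) = 1 := by
    simpa [weight, Complex.normSq_eq_conj_mul_self] using this
  exact_mod_cast h'

theorem effect_posSemidef (C : Circuit I O S M K X N) (n : ℕ) (h : Hist S M n) (s : S (n + 1))
    (m : M (n + 1)) : (C.effect n h s m).PosSemidef :=
  Matrix.posSemidef_self_mul_conjTranspose
    (Matrix.of fun (q : O n × I (n + 1)) (k : K (n + 1)) => C.U n h s (q.2, m, k) (q.1, C.zX n))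

open scoped Classical in
theorem effect_tracePreserving (C : Circuit I O S M K X N) {n : ℕ} (hn : n < N) (h : Hist S M n)
    (s : S (n + 1)) (o o' : O n) :
    ∑ m, ∑ i, C.effect n h s m (o, i) (o', i) = if o = o' then 1 else 0 := by
  have := congrFun (congrFun (C.U_isometry n hn h s) (o', C.zX n)) (o, C.zX n)
  rw [Matrix.mul_apply, Fintype.sum_prod_type] at this
  simp only [Fintype.sum_prod_type, Matrix.conjTranspose_apply, Matrix.one_apply, Prod.mk.injEq,
    and_true, eq_comm (a := o')] at this
  rw [Finset.sum_comm, ← this]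
  simp only [effect, Matrix.of_apply, mul_comm]

open scoped Classical in
/-- The diagonal blocks of a bipartite state form an ensemble of states. -/
theorem exists_initial_ensemble {A E : Type} [Fintype A] [Nonempty A] [Fintype E]
    {P : Matrix (A × E) (A × E) ℂ} (hP : P.PosSemidef) (htr : P.trace = 1) :
    ∃ (p : E → ℝ) (ρ : E → Matrix A A ℂ), (∀ e, 0 ≤ p e) ∧ ∑ e, p e = 1 ∧
      (∀ e, (ρ e).PosSemidef) ∧ (∀ e, (ρ e).trace = 1) ∧
      ∀ e, (p e : ℂ) • ρ e = Matrix.of fun a b => P (a, e) (b, e) := by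
  let B : E → Matrix A A ℂ := fun e => P.submatrix (fun a => (a, e)) (fun a => (a, e))
  have hB : ∀ e, (B e).PosSemidef := fun e => hP.submatrix _
  have hnn : ∀ e, 0 ≤ (B e).trace := fun e => (hB e).trace_nonneg
  have hre : ∀ e, (((B e).trace.re : ℝ) : ℂ) = (B e).trace := fun e =>
    (Complex.eq_re_of_ofReal_le (hnn e)).symm
  have hex : ∀ e, ∃ ρ : Matrix A A ℂ, ρ.PosSemidef ∧ ρ.trace = 1 ∧
      (((B e).trace.re : ℝ) : ℂ) • ρ = B e := fun e => by
    by_cases h0 : (B e).trace = 0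
    · obtain ⟨a⟩ := ‹Nonempty A›
      refine ⟨Matrix.single a a 1, ?_, by simp, ?_⟩
      · simpa using Matrix.posSemidef_conjTranspose_mul_self (Matrix.single a a (1 : ℂ))
      · rw [h0, (hB e).trace_eq_zero_iff.mp h0]
        simp
    · refine ⟨(B e).trace⁻¹ • B e, (hB e).smul (inv_nonneg.mpr (hnn e)), ?_, ?_⟩
      · rw [Matrix.trace_smul, smul_eq_mul, inv_mul_cancel₀ h0]
      · rw [hre, smul_smul, mul_inv_cancel₀ h0, one_smul]
  choose ρ h₁ h₂ h₃ using hex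
  refine ⟨fun e => (B e).trace.re, ρ, fun e => (Complex.nonneg_iff.mp (hnn e)).1, ?_, h₁, h₂, h₃⟩
  have : ∑ e, (B e).trace = 1 := by
    rw [← htr]
    simp only [Matrix.trace, Matrix.diag, B, Matrix.submatrix_apply, Fintype.sum_prod_type]
    exact Finset.sum_comm
  have h' : ((∑ e, (B e).trace.re : ℝ) : ℂ) = 1 := by
    rw [Complex.ofReal_sum, ← this]
    exact Finset.sum_congr rfl fun e _ => hre e
  exact_mod_cast h'

open scoped Classical in
/-- A circuit has the process matrix of classical-memory data with the same outcomes. -/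
theorem exists_classicalMemory [Nonempty (I 0)] (C : Circuit I O S M K X N)
    (r : ∀ n, Setoid (Env S M K n)) :
    ∃ D : ClassicalMemory I O (RecordSetting S M) M N, D.processMatrix = C.processMatrix r := by
  obtain ⟨p₀, ρ, hp, hsum, hρ, htr, hinit⟩ :=
    exists_initial_ensemble C.init_posSemidef C.init_trace
  let D : ClassicalMemory I O (RecordSetting S M) M N :=
    { p₀ := p₀
      p₀_nonneg := hp
      p₀_sum := hsum
      ρ := ρ
      ρ_posSemidef := hρ
      ρ_trace := htr
      p := fun n h (q : Hist S M n × S (n + 1)) =>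
        if q.1 = Hist.forget n h then C.weight n q.1 q.2 else 0
      p_nonneg := fun n _ h q => by
        split_ifs
        · exact Complex.normSq_nonneg _
        · exact le_rfl
      p_sum := fun n hn h => by
        refine (Fintype.sum_prod_type (γ := ℝ) (α₁ := Hist S M n) (α₂ := S (n + 1)) _).trans ?_
        rw [Finset.sum_eq_single (Hist.forget n h)]
        · simpa using C.weight_sum hn _
        · intro g _ hg
          simp [hg]
        · simp
      T := fun n (q : Hist S M n × S (n + 1)) m => C.effect n q.1 q.2 m
      T_posSemidef := fun n _ q m => C.effect_posSemidef n q.1 q.2 m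
      T_tracePreserving := fun n hn q o o' => C.effect_tracePreserving hn q.1 q.2 o o' }
  have hterm_succ : ∀ n (h : Hist (RecordSetting S M) M n) (g : Hist S M n) (s : S (n + 1))
      (m : M (n + 1)), D.term (n + 1) (h, (g, s), m) = D.term n h ⊗ₖ
        (((if g = Hist.forget n h then C.weight n g s else 0 : ℝ) : ℂ) • C.effect n g s m) :=
    fun _ _ _ _ _ => rfl
  have hterm_store : ∀ n (h : Hist S M n), C.branch n h = D.term n (Hist.store n h) := by
    intro n
    induction n with
    | zero => exact fun s => (hinit s).symm
    | succ n ih =>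
      rintro ⟨h, s, m⟩
      rw [Circuit.branch, Hist.store, hterm_succ, ih, Hist.forget_store, if_pos rfl]
  have hterm_zero : ∀ n (h : Hist (RecordSetting S M) M n),
      h ∉ Set.range (Hist.store (S := S) (M := M) n) → D.term n h = 0 := by
    intro n
    induction n with
    | zero => exact fun s hs => absurd ⟨s, rfl⟩ hs
    | succ n ih =>
      rintro ⟨h, ⟨g, s⟩, m⟩ hne
      rw [hterm_succ]
      by_cases hg : g = Hist.forget n h
      · rw [ih h, Matrix.zero_kronecker]
        · rfl
        rintro ⟨h', rfl⟩
        rw [Hist.forget_store] at hg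
        exact hne ⟨(h', s, m), by rw [Hist.store, hg]⟩
      · rw [if_neg hg, Complex.ofReal_zero, zero_smul, Matrix.kronecker_zero]
        rfl
  refine ⟨D, ?_⟩
  rw [processMatrix_eq_sum_branch, ClassicalMemory.processMatrix]
  exact (Fintype.sum_of_injective (Hist.store N)
    (Function.LeftInverse.injective (Hist.forget_store N)) _ _ (hterm_zero N)
    (hterm_store N)).symm

end Circuit

end ClassicalMemoryProcess

open scoped Classical in
theorem mainTheorem4 (I O : ℕ → Type) [∀ n, Fintype (I n)] [∀ n, Fintype (O n)]
    [∀ n, Nonempty (I n)] [∀ n, Nonempty (O n)] (N : ℕ) :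
    -- classical-memory processes are exactly the processes of circuits of controlled unitaries
    (∀ W : Matrix (ClassicalMemoryProcess.Sites I O N) (ClassicalMemoryProcess.Sites I O N) ℂ,
      ClassicalMemoryProcess.IsClassicalMemory I O N W ↔
        ClassicalMemoryProcess.IsCircuitProcess I O N W) ∧
    -- given data are realized on their own registers, whatever is measured on the environment
    (∀ (S M : ℕ → Type) [∀ n, Fintype (S n)] [∀ n, Fintype (M n)]
      [∀ n, Nonempty (S n)] [∀ n, Nonempty (M n)]
      (D : ClassicalMemoryProcess.ClassicalMemory I O S M N),
      ∃ (K X : ℕ → Type) (_ : ∀ n, Fintype (K n)) (_ : ∀ n, Fintype (X n))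
        (C : ClassicalMemoryProcess.Circuit I O S M K X N), C.Realizes D ∧
        ∀ r : ∀ n, Setoid (ClassicalMemoryProcess.Env S M K n),
          C.processMatrix r = D.processMatrix) ∧
    -- the whole interaction at each gate is a unitary
    (∀ (S M K X : ℕ → Type) [∀ n, Fintype (S n)] [∀ n, Fintype (M n)]
      [∀ n, Fintype (K n)] [∀ n, Fintype (X n)]
      (C : ClassicalMemoryProcess.Circuit I O S M K X N), ∀ n < N,
      (C.gate n).conjTranspose * C.gate n = 1 ∧ C.gate n * (C.gate n).conjTranspose = 1) := by
  refine ⟨fun W => ⟨?_, ?_⟩, ?_, ?_⟩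
  · rintro ⟨S, M, _, _, _, _, D, rfl⟩
    obtain ⟨C, hCD⟩ := D.exists_circuit_realizes
    exact ⟨S, M, _, _, inferInstance, inferInstance, inferInstance, inferInstance, inferInstance,
      inferInstance, C, fun _ => ⊤, hCD.processMatrix_eq _⟩
  · rintro ⟨S, M, K, X, _, _, _, _, _, _, C, r, rfl⟩
    obtain ⟨D, hD⟩ := C.exists_classicalMemory r
    exact ⟨_, M, inferInstance, inferInstance, inferInstance, inferInstance, D, hD⟩
  · intro S M _ _ _ _ D
    obtain ⟨C, hCD⟩ := D.exists_circuit_realizes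
    exact ⟨_, _, inferInstance, inferInstance, C, hCD, hCD.processMatrix_eq⟩
  · intro S M K X _ _ _ _ C n hn
    exact ⟨C.gate_isometry hn, C.gate_coisometry hn⟩
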